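/- Let $d\ge 1$ and, for $f\in L^1(\mathbb{R}^d)\cap L^2(\mathbb{R}^d)$, let $$\widehat f(\xi)=(2\pi)^{-d/2}\int_{\mathbb{R}^d} f(x)\,e^{-i\langle x,\xi\rangle}\,dx .$$ For a multi-index $\alpha\in\mathbb{N}^d$ (with $0\in\mathbb{N}$) let $$h_\alpha(x)=(-1)^{|\alpha|}\pi^{-d/4}\,(2^{|\alpha|}\alpha!)^{-1/2}\,e^{\frac12|x|^2}\,\frac{\partial^\alpha}{\partial x^\alpha}\big[e^{-|x|^2}\big]$$ be the Hermite functions, where $|\alpha|=\alpha_1+\cdots+\alpha_d$ and $\alpha!=\alpha_1!\cdots\alpha_d!$, and for $f\in L^2(\mathbb{R}^d)$ let $$H(f,\alpha)=(f,h_\alpha)_{L^2}=\int_{\mathbb{R}^d} f(x)\,h_\alpha(x)\,dx$$ be its Hermite coefficients. **Proposition 3.1.** Let $0<\lambda<1/4$ and let $f\in L^2(\mathbb{R}^d)$ be complex-valued. Suppose that there are constants $C_1,C_2$ such that, for almost every $x$ and almost every $\xi$ in $\mathbb{R}^d$, $$|f(x)|\le C_1\,e^{-(\frac12-\lambda)|x|^2},\qquad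 |\widehat f(\xi)|\le C_2\,e^{-(\frac12-\lambda)|\xi|^2}.$$ (The first bound implies $f\in L^1(\mathbb{R}^d)$.) Then for every real $h>2\sqrt d\,\big(4\lambda^2+\tfrac12\lambda\big)^{1/4}$ there is a constant $C$ (which may depend on $f,\lambda,d,h$, but not on $\alpha$) such that $$|H(f,\alpha)|\le C\,h^{|\alpha|}\qquad\text{for all }\alpha\in\mathbb{N}^d .$$ -/

import Mathlib

/-- The Fourier transform `(2π)^{-d/2} ∫ f(x) e^{-i⟨x,ξ⟩} dx` on `ℝ^d`. This integral formula is
meaningful (and agrees with the `L²` Fourier transform) for every `f ∈ L¹ ∩ L²`, in particular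
for every `f` that is bounded almost everywhere by a multiple of a decaying Gaussian. -/
noncomputable def fourierHat {d : ℕ} (f : EuclideanSpace ℝ (Fin d) → ℂ)
    (ξ : EuclideanSpace ℝ (Fin d)) : ℂ :=
  (((2 * Real.pi) ^ (-(d : ℝ) / 2) : ℝ) : ℂ) *
    ∫ x, f x * Complex.exp (-Complex.I * ((inner ℝ x ξ : ℝ) : ℂ))

/-- The partial derivative `∂g/∂x_j` on `ℝ^d`. -/
noncomputable def partialDeriv {d : ℕ} (j : Fin d) (g : EuclideanSpace ℝ (Fin d) → ℝ) :
    EuclideanSpace ℝ (Fin d) → ℝ :=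
  fun x => lineDeriv ℝ g x (EuclideanSpace.single j 1)

/-- The mixed partial derivative `∂^α g = ∂_0^{α_0} ⋯ ∂_{d-1}^{α_{d-1}} g`. -/
noncomputable def multiPartialDeriv {d : ℕ} (α : Fin d → ℕ)
    (g : EuclideanSpace ℝ (Fin d) → ℝ) : EuclideanSpace ℝ (Fin d) → ℝ :=
  (List.finRange d).foldr (fun j u => (partialDeriv j)^[α j] u) g

/-- The length `|α| = α_0 + ⋯ + α_{d-1}` of a multi-index. -/
def multiLength {d : ℕ} (α : Fin d → ℕ) : ℕ := ∑ j, α j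

/-- The factorial `α! = α_0! ⋯ α_{d-1}!` of a multi-index. -/
def multiFactorial {d : ℕ} (α : Fin d → ℕ) : ℕ := ∏ j, (α j).factorial

/-- The Hermite function
`h_α(x) = (-1)^{|α|} π^{-d/4} (2^{|α|} α!)^{-1/2} e^{|x|²/2} ∂^α [e^{-|x|²}]`. -/
noncomputable def hermiteFunction {d : ℕ} (α : Fin d → ℕ) (x : EuclideanSpace ℝ (Fin d)) : ℝ :=
  (-1) ^ multiLength α * Real.pi ^ (-(d : ℝ) / 4) *
    ((2 : ℝ) ^ multiLength α * (multiFactorial α : ℝ)) ^ (-(1 / 2) : ℝ) *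
    Real.exp (1 / 2 * ‖x‖ ^ 2) * multiPartialDeriv α (fun y => Real.exp (-‖y‖ ^ 2)) x

/-- The Hermite coefficient `H(f, α) = (f, h_α)_{L²}`; the function `h_α` is real-valued, so no
complex conjugate appears. -/
noncomputable def hermiteCoeff {d : ℕ} (f : EuclideanSpace ℝ (Fin d) → ℂ) (α : Fin d → ℕ) : ℂ :=
  ∫ x, f x * (hermiteFunction α x : ℂ)

/-! The proof passes through a Bargmann transform restricted to complex lines, `B(ζ, x) = ∫ f(t)
exp(-|t|²/2 + 2ζ⟨x,t⟩ - ζ²|x|²) dt`, entire in `ζ`. Completing the square, the decay of `f` gives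
`|B| ≤ C exp(|x|² ((Im ζ)² + κ (Re ζ)²))` with `κ = λ/(1-λ)`. The Fourier transform acts as the
rotation `ζ ↦ iζ` (`bargmannTransform_fourierHat`), so the decay of `f̂` gives the same bound with
`Re ζ` and `Im ζ` exchanged. Phragmén–Lindelöf between the two axes
(`norm_le_of_quadratic_growth_axes`) upgrades the pair to `|B| ≤ C exp(√κ |ζ|² |x|²)` in all
directions.

Now integrate `B(ζ, x)` against `h_α(x) e^{-|x|²/2}`. This pairing is holomorphic on `|ζ| < r` as
soon as `√κ r² < 1/2`, and since `‖h_α‖₂ = 1` it is bounded there independently of `α`. The kernel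
equals `e^{|t|²/2} e^{-|t-ζx|²}`, and integrating by parts in `x` pulls out `ζ^{|α|}` and moves
`∂^α` onto the second Gaussian; as `ζ → 0` the remaining factor tends to `π^{d/2} H(f, α)`. Cauchy's
estimate with `r = 1/h` then bounds `H(f, α)` by a constant times `h^{|α|}`. The argument needs only
`h² > 2√κ`, which follows from the stated threshold. -/

/-! ### One-variable derivatives of the Gaussian. -/

open Polynomial in
/-- The polynomial `P n` with `(d/dx)^n e^{-x²} = P n (x) e^{-x²}`. -/
noncomputable def gaussDerivPoly : ℕ → ℝ[X]
  | 0 => 1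
  | n + 1 => derivative (gaussDerivPoly n) - 2 * X * gaussDerivPoly n

/-- The `n`-th derivative of `e^{-x²}`. -/
noncomputable def gaussDeriv (n : ℕ) (x : ℝ) : ℝ :=
  (gaussDerivPoly n).eval x * Real.exp (-x ^ 2)

@[simp] lemma gaussDeriv_zero (x : ℝ) : gaussDeriv 0 x = Real.exp (-x ^ 2) := by
  simp [gaussDeriv, gaussDerivPoly]

lemma hasDerivAt_gaussDeriv (n : ℕ) (x : ℝ) :
    HasDerivAt (gaussDeriv n) (gaussDeriv (n + 1) x) x := by
  have h1 := (gaussDerivPoly n).hasDerivAt x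
  have h2 : HasDerivAt (fun x : ℝ => Real.exp (-x ^ 2)) (Real.exp (-x ^ 2) * (-(2 * x))) x := by
    have := ((hasDerivAt_pow 2 x).neg).exp
    simpa using this
  convert! h1.mul h2 using 1
  simp only [gaussDeriv, gaussDerivPoly, Polynomial.eval_sub, Polynomial.eval_mul,
    Polynomial.eval_X, Polynomial.eval_ofNat]
  ring

lemma continuous_gaussDeriv (n : ℕ) : Continuous (gaussDeriv n) := by
  unfold gaussDeriv
  fun_prop

/-- Up to the sign `(-1)^n`, `gaussDerivPoly n` is the physicists' Hermite polynomial; this is its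
lowering relation, needed for the `L²` norms. -/
lemma derivative_gaussDerivPoly (n : ℕ) :
    Polynomial.derivative (gaussDerivPoly (n + 1)) =
      Polynomial.C (-(2 * ((n : ℝ) + 1))) * gaussDerivPoly n := by
  induction n with
  | zero =>
    simp [gaussDerivPoly, ← Polynomial.C_ofNat]
  | succ n ih =>
    rw [gaussDerivPoly, ih]
    simp only [Polynomial.derivative_sub, Polynomial.derivative_mul, Polynomial.derivative_C,
      Polynomial.derivative_X, Polynomial.derivative_ofNat, ih]
    conv_rhs => rw [gaussDerivPoly]
    conv_lhs => rw [gaussDerivPoly]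
    push_cast
    simp only [map_neg, map_mul, map_add, map_one, map_ofNat]
    ring

lemma exists_abs_eval_mul_exp_le (p : Polynomial ℝ) {δ : ℝ} (hδ : 0 < δ) :
    ∃ C : ℝ, ∀ x, |p.eval x| * Real.exp (-δ * x ^ 2) ≤ C := by
  induction p using Polynomial.induction_on' with
  | add p q hp hq =>
    obtain ⟨A, hA⟩ := hp
    obtain ⟨B, hB⟩ := hq
    refine ⟨A + B, fun x => ?_⟩
    calc |(p + q).eval x| * Real.exp (-δ * x ^ 2)
        ≤ (|p.eval x| + |q.eval x|) * Real.exp (-δ * x ^ 2) := by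
          rw [Polynomial.eval_add]; gcongr; exact abs_add_le _ _
      _ ≤ A + B := by rw [add_mul]; exact add_le_add (hA x) (hB x)
  | monomial n a =>
    refine ⟨|a| * (1 + n.factorial / δ ^ n), fun x => ?_⟩
    rw [Polynomial.eval_monomial, abs_mul, mul_assoc]
    gcongr
    have h1 : (δ * x ^ 2) ^ n / n.factorial ≤ Real.exp (δ * x ^ 2) :=
      Real.pow_div_factorial_le_exp _ (by positivity) n
    have h2 : |x ^ n| ≤ 1 + (x ^ 2) ^ n := by
      rw [← pow_mul, mul_comm 2 n, pow_mul, ← sq_abs (x ^ n)]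
      nlinarith [sq_nonneg (|x ^ n| - 1), abs_nonneg (x ^ n)]
    have h3 : (x ^ 2) ^ n ≤ n.factorial / δ ^ n * Real.exp (δ * x ^ 2) := by
      rw [mul_pow, div_le_iff₀ (by positivity)] at h1
      rw [div_mul_eq_mul_div, le_div_iff₀ (by positivity)]
      linarith
    have h4 : (1 : ℝ) ≤ Real.exp (δ * x ^ 2) := Real.one_le_exp (by positivity)
    rw [neg_mul, Real.exp_neg, ← div_eq_mul_inv, div_le_iff₀ (Real.exp_pos _), add_mul, one_mul]
    linarith

lemma exists_abs_eval_mul_exp_le_exp (p : Polynomial ℝ) {δ ε : ℝ} (h : ε < δ) :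
    ∃ C : ℝ, ∀ x, |p.eval x| * Real.exp (-δ * x ^ 2) ≤ C * Real.exp (-ε * x ^ 2) := by
  obtain ⟨C, hC⟩ := exists_abs_eval_mul_exp_le p (sub_pos.2 h)
  refine ⟨C, fun x => ?_⟩
  have : Real.exp (-δ * x ^ 2) = Real.exp (-(δ - ε) * x ^ 2) * Real.exp (-ε * x ^ 2) := by
    rw [← Real.exp_add]; ring_nf
  rw [this, ← mul_assoc]
  gcongr
  exact hC x

lemma integrable_eval_mul_exp (p : Polynomial ℝ) {δ : ℝ} (hδ : 0 < δ) :
    MeasureTheory.Integrable (fun x : ℝ => p.eval x * Real.exp (-δ * x ^ 2)) := by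
  obtain ⟨C, hC⟩ := exists_abs_eval_mul_exp_le_exp p (half_lt_self hδ)
  refine ((integrable_exp_neg_mul_sq (half_pos hδ)).const_mul C).mono'
    (by fun_prop) (Filter.Eventually.of_forall fun x => ?_)
  simpa [abs_mul] using hC x

lemma exists_abs_gaussDeriv_le (n : ℕ) :
    ∃ C : ℝ, 0 ≤ C ∧ ∀ x, |gaussDeriv n x| ≤ C * Real.exp (-(3 / 4) * x ^ 2) := by
  obtain ⟨C, hC⟩ := exists_abs_eval_mul_exp_le_exp (gaussDerivPoly n)
    (show (3 / 4 : ℝ) < 1 by norm_num)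
  have h : ∀ x, |gaussDeriv n x| ≤ C * Real.exp (-(3 / 4) * x ^ 2) := fun x => by
    simpa [gaussDeriv, abs_mul] using hC x
  refine ⟨C, ?_, h⟩
  have := (abs_nonneg _).trans (h 0)
  simpa using this

lemma integrable_gaussDeriv (n : ℕ) : MeasureTheory.Integrable (gaussDeriv n) := by
  exact (integrable_eval_mul_exp (gaussDerivPoly n) one_pos).congr
    (Filter.Eventually.of_forall fun x => by simp [gaussDeriv])

lemma integrable_gaussDeriv_mul_gaussDeriv_comp (m k : ℕ) (s z : ℝ) :
    MeasureTheory.Integrable (fun x => gaussDeriv m x * gaussDeriv k (s - z * x)) := by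
  obtain ⟨C, hC0, hC⟩ := exists_abs_gaussDeriv_le k
  refine (integrable_gaussDeriv m).mul_bdd (c := C) ?_ (Filter.Eventually.of_forall fun x => ?_)
  · exact ((continuous_gaussDeriv k).comp (by fun_prop)).aestronglyMeasurable
  · refine (hC _).trans (mul_le_of_le_one_right hC0 (Real.exp_le_one_iff.2 ?_))
    nlinarith [sq_nonneg (s - z * x)]

/-- Moving `m` derivatives by integration by parts. -/
lemma integral_gaussDeriv_mul_gaussDeriv_comp (m k : ℕ) (s z : ℝ) :
    ∫ x, gaussDeriv m x * gaussDeriv k (s - z * x) =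
      z ^ m * ∫ x, gaussDeriv 0 x * gaussDeriv (k + m) (s - z * x) := by
  induction m generalizing k with
  | zero => simp
  | succ m ih =>
    have hu : ∀ x, HasDerivAt (fun x => gaussDeriv k (s - z * x))
        (-z * gaussDeriv (k + 1) (s - z * x)) x := fun x => by
      have h2 : HasDerivAt (fun x : ℝ => s - z * x) (-z) x := by
        simpa using ((hasDerivAt_id x).const_mul z).const_sub s
      have := (hasDerivAt_gaussDeriv k (s - z * x)).comp x h2
      simpa [mul_comm, Function.comp_def] using this
    have key := MeasureTheory.integral_mul_deriv_eq_deriv_mul_of_integrable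
      (u := fun x => gaussDeriv k (s - z * x)) (v := gaussDeriv m)
      (fun x _ => hu x) (fun x _ => hasDerivAt_gaussDeriv m x)
      (by
        refine (integrable_gaussDeriv_mul_gaussDeriv_comp (m + 1) k s z).congr
          (Filter.Eventually.of_forall fun x => ?_)
        simp [mul_comm])
      (by
        refine ((integrable_gaussDeriv_mul_gaussDeriv_comp m (k + 1) s z).const_mul (-z)).congr
          (Filter.Eventually.of_forall fun x => ?_)
        simp only [Pi.mul_apply]; ring)
      (by
        refine (integrable_gaussDeriv_mul_gaussDeriv_comp m k s z).congr
          (Filter.Eventually.of_forall fun x => ?_)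
        simp [mul_comm])
    calc ∫ x, gaussDeriv (m + 1) x * gaussDeriv k (s - z * x)
        = ∫ x, gaussDeriv k (s - z * x) * gaussDeriv (m + 1) x := by simp_rw [mul_comm]
      _ = -∫ x, -z * gaussDeriv (k + 1) (s - z * x) * gaussDeriv m x := key
      -- The sign from integration by parts cancels that of the chain-rule factor `-z`.
      _ = z * ∫ x, gaussDeriv m x * gaussDeriv (k + 1) (s - z * x) := by
        rw [← MeasureTheory.integral_neg, ← MeasureTheory.integral_const_mul]
        congr 1; ext x; ring
      _ = _ := by rw [ih, ← mul_assoc, ← pow_succ']; congr 4; ext x; congr 2; omega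

lemma integrable_gaussDerivPoly_sq (n : ℕ) :
    MeasureTheory.Integrable (fun x => (gaussDerivPoly n).eval x ^ 2 * Real.exp (-x ^ 2)) := by
  exact (integrable_eval_mul_exp (gaussDerivPoly n ^ 2) one_pos).congr
    (Filter.Eventually.of_forall fun x => by simp)

/-- One of the two factors together with the weight is a derivative of a Gaussian; integrating by
parts and lowering the other factor gives a recursion with ratio `2 (n + 1)`. -/
lemma integral_gaussDerivPoly_sq (n : ℕ) :
    ∫ x, (gaussDerivPoly n).eval x ^ 2 * Real.exp (-x ^ 2) =
      2 ^ n * n.factorial * Real.sqrt Real.pi := by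
  induction n with
  | zero =>
    simpa [gaussDerivPoly] using integral_gaussian 1
  | succ n ih =>
    have hi : ∀ p q : Polynomial ℝ, MeasureTheory.Integrable
        (fun x => p.eval x * (q.eval x * Real.exp (-x ^ 2))) := fun p q => by
      simpa [Polynomial.eval_mul, mul_assoc] using integrable_eval_mul_exp (p * q) one_pos
    have key := MeasureTheory.integral_mul_deriv_eq_deriv_mul_of_integrable
      (u := fun x => (gaussDerivPoly (n + 1)).eval x) (v := gaussDeriv n)
      (fun x _ => (gaussDerivPoly (n + 1)).hasDerivAt x)
      (fun x _ => hasDerivAt_gaussDeriv n x) (hi _ _) (hi _ _) (hi _ _)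
    calc ∫ x, (gaussDerivPoly (n + 1)).eval x ^ 2 * Real.exp (-x ^ 2)
        = ∫ x, (gaussDerivPoly (n + 1)).eval x * gaussDeriv (n + 1) x := by
          congr 1; ext x; simp only [gaussDeriv]; ring
      _ = _ := key
      _ = 2 * ((n : ℝ) + 1) * ∫ x, (gaussDerivPoly n).eval x ^ 2 * Real.exp (-x ^ 2) := by
        rw [← MeasureTheory.integral_neg, ← MeasureTheory.integral_const_mul]
        congr 1; ext x
        rw [derivative_gaussDerivPoly, Polynomial.eval_mul, Polynomial.eval_C, gaussDeriv]
        ring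
      _ = _ := by rw [ih, Nat.factorial_succ]; push_cast; ring

/-! ### Partial derivatives of the Gaussian and Hermite functions in several variables. -/

/-- `∏ⱼ` of one-dimensional derivatives of Gaussians: the partial derivatives of `e^{-|x|²}`. -/
noncomputable def gaussPartial {d : ℕ} (β : Fin d → ℕ) (x : EuclideanSpace ℝ (Fin d)) : ℝ :=
  ∏ j, gaussDeriv (β j) (x j)

lemma partialDeriv_gaussPartial {d : ℕ} (β : Fin d → ℕ) (j : Fin d) :
    partialDeriv j (gaussPartial β) = gaussPartial (β + Pi.single j 1) := by
  ext x
  have h : HasDerivAt (fun t : ℝ => gaussPartial β (x + t • EuclideanSpace.single j 1))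
      (gaussPartial (β + Pi.single j 1) x) 0 := by
    have h1 : HasDerivAt (fun t : ℝ => gaussDeriv (β j) (x j + t)) (gaussDeriv (β j + 1) (x j))
        0 := by
      have := (hasDerivAt_gaussDeriv (β j) (x j + 0)).comp_const_add (x j) 0
      simpa using this
    have h2 := h1.mul_const (∏ i ∈ Finset.univ.erase j, gaussDeriv (β i) (x i))
    convert! h2 using 1
    · ext t
      rw [gaussPartial, ← Finset.mul_prod_erase _ _ (Finset.mem_univ j)]
      congr 1
      · simp
      · refine Finset.prod_congr rfl fun i hi => ?_
        simp [(Finset.mem_erase.1 hi).1]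
    · rw [gaussPartial, ← Finset.mul_prod_erase _ _ (Finset.mem_univ j)]
      congr 1
      · simp
      · refine Finset.prod_congr rfl fun i hi => ?_
        simp [(Finset.mem_erase.1 hi).1]
  exact h.deriv

lemma iterate_partialDeriv_gaussPartial {d : ℕ} (β : Fin d → ℕ) (j : Fin d) (n : ℕ) :
    (partialDeriv j)^[n] (gaussPartial β) = gaussPartial (β + Pi.single j n) := by
  induction n with
  | zero => simp
  | succ n ih =>
    rw [Function.iterate_succ_apply', ih, partialDeriv_gaussPartial, add_assoc, ← Pi.single_add]

lemma gaussPartial_zero {d : ℕ} (x : EuclideanSpace ℝ (Fin d)) :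
    gaussPartial 0 x = Real.exp (-‖x‖ ^ 2) := by
  simp [gaussPartial, ← Real.exp_sum, EuclideanSpace.norm_sq_eq]

lemma multiPartialDeriv_gaussian {d : ℕ} (α : Fin d → ℕ) :
    multiPartialDeriv α (fun y : EuclideanSpace ℝ (Fin d) => Real.exp (-‖y‖ ^ 2)) =
      gaussPartial α := by
  have h0 : (fun y : EuclideanSpace ℝ (Fin d) => Real.exp (-‖y‖ ^ 2)) = gaussPartial 0 := by
    ext y; rw [gaussPartial_zero]
  -- Stated for arbitrary lists so that induction applies; the multiplicities `l.count i` all become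
  -- 1 for `List.finRange d`.
  have key : ∀ l : List (Fin d),
      l.foldr (fun j u => (partialDeriv j)^[α j] u) (gaussPartial (0 : Fin d → ℕ)) =
        gaussPartial (fun i => l.count i * α i) := by
    intro l
    induction l with
    | nil => simp; rfl
    | cons j l ih =>
      rw [List.foldr_cons, ih, iterate_partialDeriv_gaussPartial]
      congr 1
      ext i
      by_cases h : i = j
      · subst h
        simp [add_mul]
      · simp [h, List.count_cons_of_ne (Ne.symm h)]
  rw [multiPartialDeriv, h0, key]
  congr 1
  ext i
  rw [List.count_eq_one_of_mem (List.nodup_finRange d) (List.mem_finRange i), one_mul]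

lemma integral_prod_euclideanSpace {d : ℕ} (f : Fin d → ℝ → ℝ) :
    ∫ x : EuclideanSpace ℝ (Fin d), ∏ j, f j (x j) = ∏ j, ∫ t, f j t := by
  rw [← MeasureTheory.integral_fintype_prod_volume_eq_prod,
    ← (PiLp.volume_preserving_toLp (Fin d)).integral_comp
      (MeasurableEquiv.toLp 2 _).measurableEmbedding]

lemma integrable_prod_euclideanSpace {d : ℕ} {f : Fin d → ℝ → ℝ}
    (hf : ∀ j, MeasureTheory.Integrable (f j)) :
    MeasureTheory.Integrable (fun x : EuclideanSpace ℝ (Fin d) => ∏ j, f j (x j)) := by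
  rw [← (PiLp.volume_preserving_toLp (Fin d)).integrable_comp_emb
      (MeasurableEquiv.toLp 2 _).measurableEmbedding]
  exact MeasureTheory.Integrable.fintype_prod hf

/-- The normalizing factor `(-1)^{|α|} π^{-d/4} (2^{|α|} α!)^{-1/2}` of the Hermite functions. -/
noncomputable def hermiteNormalizer {d : ℕ} (α : Fin d → ℕ) : ℝ :=
  (-1) ^ multiLength α * Real.pi ^ (-(d : ℝ) / 4) *
    ((2 : ℝ) ^ multiLength α * (multiFactorial α : ℝ)) ^ (-(1 / 2) : ℝ)

lemma hermiteFunction_eq {d : ℕ} (α : Fin d → ℕ) (x : EuclideanSpace ℝ (Fin d)) :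
    hermiteFunction α x =
      hermiteNormalizer α * Real.exp (1 / 2 * ‖x‖ ^ 2) * gaussPartial α x := by
  rw [hermiteFunction, multiPartialDeriv_gaussian, hermiteNormalizer]

lemma hermiteFunction_sq {d : ℕ} (α : Fin d → ℕ) (x : EuclideanSpace ℝ (Fin d)) :
    hermiteFunction α x ^ 2 = hermiteNormalizer α ^ 2 *
      ∏ j, ((gaussDerivPoly (α j)).eval (x j) ^ 2 * Real.exp (-(x j) ^ 2)) := by
  have h : Real.exp (1 / 2 * ‖x‖ ^ 2) ^ 2 * ∏ j, Real.exp (-(x j) ^ 2) = 1 := by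
    rw [← Real.exp_sum, ← Real.exp_nat_mul, ← Real.exp_add, EuclideanSpace.norm_sq_eq]
    simp
  rw [hermiteFunction_eq, gaussPartial]
  simp only [gaussDeriv, Finset.prod_mul_distrib, Finset.prod_pow]
  linear_combination (hermiteNormalizer α ^ 2 * (∏ j, (gaussDerivPoly (α j)).eval (x j)) ^ 2 *
    ∏ j, Real.exp (-(x j) ^ 2)) * h

lemma integrable_hermiteFunction_sq {d : ℕ} (α : Fin d → ℕ) :
    MeasureTheory.Integrable (fun x => hermiteFunction α x ^ 2) := by
  simp_rw [hermiteFunction_sq]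
  exact (integrable_prod_euclideanSpace fun j => integrable_gaussDerivPoly_sq (α j)).const_mul _

/-- This normalization is what makes the later bounds uniform in `α`. -/
lemma integral_hermiteFunction_sq {d : ℕ} (α : Fin d → ℕ) :
    ∫ x, hermiteFunction α x ^ 2 = 1 := by
  simp_rw [hermiteFunction_sq]
  rw [MeasureTheory.integral_const_mul, integral_prod_euclideanSpace
    (fun j t => (gaussDerivPoly (α j)).eval t ^ 2 * Real.exp (-t ^ 2))]
  simp_rw [integral_gaussDerivPoly_sq]
  simp only [Finset.prod_mul_distrib, Finset.prod_pow_eq_pow_sum, Finset.prod_const,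
    Finset.card_univ, Fintype.card_fin]
  have hN : (0 : ℝ) < (2 : ℝ) ^ multiLength α * (multiFactorial α : ℝ) := by
    have : 0 < multiFactorial α := Finset.prod_pos fun j _ => Nat.factorial_pos _
    positivity
  have e1 : (((2 : ℝ) ^ multiLength α * (multiFactorial α : ℝ)) ^ (-(1 / 2) : ℝ)) ^ 2 =
      ((2 : ℝ) ^ multiLength α * (multiFactorial α : ℝ))⁻¹ := by
    rw [← Real.rpow_natCast, ← Real.rpow_mul hN.le, ← Real.rpow_neg_one]
    norm_num
  have e2 : (Real.pi ^ (-(d : ℝ) / 4)) ^ 2 * Real.sqrt Real.pi ^ d = 1 := by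
    rw [Real.sqrt_eq_rpow, ← Real.rpow_natCast, ← Real.rpow_mul Real.pi_pos.le,
      ← Real.rpow_natCast, ← Real.rpow_mul Real.pi_pos.le, ← Real.rpow_add Real.pi_pos]
    convert Real.rpow_zero Real.pi using 2
    push_cast
    ring
  have e3 : ((2 : ℝ) ^ ∑ j, α j) * ∏ j, ((α j).factorial : ℝ) =
      (2 : ℝ) ^ multiLength α * (multiFactorial α : ℝ) := by
    simp [multiLength, multiFactorial]
  rw [e3, hermiteNormalizer, mul_pow, mul_pow, e1, ← pow_mul, mul_comm _ 2, pow_mul]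
  rw [show ((-1 : ℝ) ^ 2) ^ multiLength α = 1 by norm_num]
  linear_combination e2 + (Real.pi ^ (-(d : ℝ) / 4)) ^ 2 * Real.sqrt Real.pi ^ d *
    inv_mul_cancel₀ hN.ne'

lemma continuous_gaussPartial {d : ℕ} (α : Fin d → ℕ) : Continuous (gaussPartial α) := by
  unfold gaussPartial
  exact continuous_finsetProd _ fun j _ => (continuous_gaussDeriv _).comp (by fun_prop)

lemma continuous_hermiteFunction {d : ℕ} (α : Fin d → ℕ) : Continuous (hermiteFunction α) := by
  have : hermiteFunction α = fun x => hermiteNormalizer α * Real.exp (1 / 2 * ‖x‖ ^ 2) *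
    gaussPartial α x := by ext x; rw [hermiteFunction_eq]
  rw [this]
  exact (by fun_prop : Continuous fun x : EuclideanSpace ℝ (Fin d) =>
    hermiteNormalizer α * Real.exp (1 / 2 * ‖x‖ ^ 2)).mul (continuous_gaussPartial α)

lemma exists_abs_gaussPartial_le {d : ℕ} (α : Fin d → ℕ) :
    ∃ C : ℝ, 0 ≤ C ∧ ∀ x : EuclideanSpace ℝ (Fin d),
      |gaussPartial α x| ≤ C * Real.exp (-(3 / 4) * ‖x‖ ^ 2) := by
  choose C hC0 hC using fun j => exists_abs_gaussDeriv_le (α j)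
  refine ⟨∏ j, C j, Finset.prod_nonneg fun j _ => hC0 j, fun x => ?_⟩
  rw [gaussPartial, Finset.abs_prod, EuclideanSpace.norm_sq_eq, Finset.mul_sum, Real.exp_sum,
    ← Finset.prod_mul_distrib]
  refine Finset.prod_le_prod (fun j _ => abs_nonneg _) fun j _ => ?_
  simpa using hC j (x j)

/-- Integration by parts against the Gaussian `e^{-|t - z x|²}` in several variables. -/
lemma integral_gaussPartial_mul_gaussian_comp {d : ℕ} (α : Fin d → ℕ) (z : ℝ)
    (t : EuclideanSpace ℝ (Fin d)) :
    ∫ x, gaussPartial α x * Real.exp (-‖t - z • x‖ ^ 2) =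
      z ^ multiLength α * ∫ x, Real.exp (-‖x‖ ^ 2) * gaussPartial α (t - z • x) := by
  simp_rw [← gaussPartial_zero, gaussPartial, ← Finset.prod_mul_distrib]
  simp only [PiLp.sub_apply, PiLp.smul_apply, smul_eq_mul]
  rw [integral_prod_euclideanSpace (fun j u => gaussDeriv (α j) u *
      gaussDeriv ((0 : Fin d → ℕ) j) (t j - z * u)),
    integral_prod_euclideanSpace (fun j u => gaussDeriv ((0 : Fin d → ℕ) j) u *
      gaussDeriv (α j) (t j - z * u)), multiLength, ← Finset.prod_pow_eq_pow_sum,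
    ← Finset.prod_mul_distrib]
  refine Finset.prod_congr rfl fun j _ => ?_
  simpa using integral_gaussDeriv_mul_gaussDeriv_comp (α j) 0 (t j) z

/-! ### Tools from complex analysis. -/

open Filter Topology Complex in
/-- A holomorphic family of functions, locally dominated by an integrable function, has a
holomorphic integral. -/
lemma differentiableOn_integral_of_dominated {X : Type*} [MeasurableSpace X]
    {μ : MeasureTheory.Measure X} {K : ℂ → X → ℂ} {U : Set ℂ} (hU : IsOpen U)
    (hmeas : ∀ z ∈ U, MeasureTheory.AEStronglyMeasurable (K z) μ)
    (hdiff : ∀ᵐ a ∂μ, DifferentiableOn ℂ (fun z => K z a) U)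
    (hbound : ∀ z₀ ∈ U, ∃ V ∈ 𝓝 z₀, ∃ b : X → ℝ, MeasureTheory.Integrable b μ ∧
      ∀ᵐ a ∂μ, ∀ z ∈ V, ‖K z a‖ ≤ b a) :
    DifferentiableOn ℂ (fun z => ∫ a, K z a ∂μ) U := by
  intro z₀ hz₀
  obtain ⟨V, hV, b, hb, hKb⟩ := hbound z₀ hz₀
  obtain ⟨ε, hε, hball⟩ := Metric.mem_nhds_iff.1 (inter_mem hV (hU.mem_nhds hz₀))
  have hδ : 0 < ε / 2 := half_pos hε
  have hsub : ∀ w ∈ Metric.ball z₀ (ε / 2), Metric.closedBall w (ε / 4) ⊆ Metric.ball z₀ ε := by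
    intro w hw u hu
    rw [Metric.mem_ball] at hw ⊢
    rw [Metric.mem_closedBall] at hu
    linarith [dist_triangle u w z₀]
  have hd : ∀ᵐ a ∂μ, ∀ w ∈ Metric.ball z₀ (ε / 2),
      HasDerivAt (fun z => K z a) (deriv (fun z => K z a) w) w := by
    filter_upwards [hdiff] with a ha w hw
    refine (ha.differentiableAt (hU.mem_nhds ?_)).hasDerivAt
    exact (hball (hsub w hw (Metric.mem_closedBall_self (by linarith)))).2
  refine (hasDerivAt_integral_of_dominated_loc_of_deriv_le (s := Metric.ball z₀ (ε / 2))
    (bound := fun a => b a / (ε / 4)) (F' := fun w a => deriv (fun z => K z a) w)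
    (Metric.ball_mem_nhds _ hδ) ?_ ?_ ?_ ?_ (hb.div_const _) hd).2.differentiableAt
      |>.differentiableWithinAt
  · filter_upwards [hU.mem_nhds hz₀] with z hz using hmeas z hz
  · refine hb.mono' (hmeas z₀ hz₀) ?_
    filter_upwards [hKb] with a ha using ha z₀ (mem_of_mem_nhds hV)
  -- The derivative is measurable in `a` as an a.e. limit of difference quotients along a real
  -- sequence tending to `z₀` inside `U`.
  · have hmem : ∀ n : ℕ, z₀ + ((ε / 2 / (n + 2) : ℝ) : ℂ) ∈ U := fun n => by
      refine (hball ?_).2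
      rw [Metric.mem_ball, dist_eq_norm, add_sub_cancel_left, Complex.norm_real,
        Real.norm_of_nonneg (by positivity), div_lt_iff₀ (by positivity)]
      nlinarith [(Nat.cast_nonneg n : (0 : ℝ) ≤ n)]
    refine aestronglyMeasurable_of_tendsto_ae atTop (f := fun (n : ℕ) a =>
      (((ε / 2 / (n + 2) : ℝ) : ℂ))⁻¹ • (K (z₀ + ((ε / 2 / (n + 2) : ℝ) : ℂ)) a - K z₀ a))
      (fun n => ((hmeas _ (hmem n)).sub (hmeas _ hz₀)).const_smul
        (((ε / 2 / (n + 2) : ℝ) : ℂ))⁻¹) ?_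
    filter_upwards [hd] with a ha
    have h0 := (ha z₀ (Metric.mem_ball_self hδ)).tendsto_slope_zero
    refine h0.comp (tendsto_nhdsWithin_iff.2 ⟨?_, Eventually.of_forall fun n => ?_⟩)
    · have : Tendsto (fun n : ℕ => ε / 2 / ((n : ℝ) + 2)) atTop (𝓝 0) :=
        tendsto_const_nhds.div_atTop
          (tendsto_atTop_add_const_right _ _ tendsto_natCast_atTop_atTop)
      exact_mod_cast (Complex.continuous_ofReal.tendsto 0).comp this
    · have : ε / 2 / ((n : ℝ) + 2) ≠ 0 := by positivity
      simpa only [Set.mem_compl_iff, Set.mem_singleton_iff, Complex.ofReal_eq_zero] using this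
  -- Cauchy's estimate on the circle of radius `ε / 4` about `w` turns the domination of `K` into
  -- one of its derivative.
  · filter_upwards [hKb, hdiff] with a ha hda w hw
    refine Complex.norm_deriv_le_of_forall_mem_sphere_norm_le (by linarith) ?_ fun z hz => ?_
    · refine DifferentiableOn.diffContOnCl ?_
      refine hda.mono ?_
      rw [closure_ball _ (by linarith : ε / 4 ≠ 0)]
      exact (hsub w hw).trans (hball.trans Set.inter_subset_right)
    · exact ha z (hball (hsub w hw (Metric.sphere_subset_closedBall hz))).1

open Filter Topology in
/-- A Cauchy estimate for the leading Taylor coefficient, detected along positive reals. -/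
lemma norm_le_of_tendsto_div_pow {Ψ : ℂ → ℂ} {r M : ℝ} (hr : 0 < r) {n : ℕ}
    (hd : DifferentiableOn ℂ Ψ (Metric.ball 0 r)) (hM : ∀ z ∈ Metric.ball (0 : ℂ) r, ‖Ψ z‖ ≤ M)
    {L : ℂ} (hL : Tendsto (fun s : ℝ => Ψ s / (s : ℂ) ^ n) (𝓝[>] 0) (𝓝 L)) :
    ‖L‖ ≤ M / r ^ n := by
  have hreal : Tendsto (fun s : ℝ => (s : ℂ)) (𝓝[>] 0) (𝓝 0) :=
    (Complex.continuous_ofReal.tendsto' 0 0 (by simp)).mono_left nhdsWithin_le_nhds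
  induction n generalizing Ψ M with
  | zero =>
    have h0 : (0 : ℂ) ∈ Metric.ball (0 : ℂ) r := Metric.mem_ball_self hr
    have hc : Tendsto Ψ (𝓝 0) (𝓝 (Ψ 0)) :=
      (hd.differentiableAt (Metric.isOpen_ball.mem_nhds h0)).continuousAt
    have : L = Ψ 0 := tendsto_nhds_unique (by simpa [Function.comp_def] using hL) (hc.comp hreal)
    simpa [this] using hM 0 h0
  | succ n ih =>
    have hnhds : Metric.ball (0 : ℂ) r ∈ 𝓝 0 := Metric.ball_mem_nhds _ hr
    have hc : Tendsto Ψ (𝓝 0) (𝓝 (Ψ 0)) := (hd.differentiableAt hnhds).continuousAt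
    have h0 : Ψ 0 = 0 := by
      refine tendsto_nhds_unique (hc.comp hreal) ?_
      have h1 := hL.mul (hreal.pow (n + 1))
      simp only [ne_eq, Nat.add_eq_zero_iff, one_ne_zero, and_false, not_false_eq_true, zero_pow,
        mul_zero] at h1
      refine h1.congr' ?_
      filter_upwards [self_mem_nhdsWithin] with s hs
      have : (s : ℂ) ≠ 0 := by exact_mod_cast (ne_of_gt hs)
      simp [this]
    -- As `Ψ 0 = 0`, the Schwarz lemma bounds `Ψ z / z` by `M / r`, and dividing by `z` lowers the
    -- order by one.
    have := ih (Ψ := dslope Ψ 0) (M := M / r)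
      ((Complex.differentiableOn_dslope hnhds).2 hd)
      (fun z hz => Complex.norm_dslope_le_div_of_mapsTo_ball hd
        (fun w hw => by simpa [h0] using hM w hw) hz)
      (by
        refine hL.congr' ?_
        filter_upwards [self_mem_nhdsWithin] with s hs
        have : (s : ℂ) ≠ 0 := by exact_mod_cast (ne_of_gt hs)
        rw [dslope_of_ne _ this, slope_def_field, h0]
        field_simp
        simp only [sub_zero]
        ring)
    rwa [div_div, ← pow_succ'] at this

open Complex Filter in
/-- A Phragmén–Lindelöf estimate in the sector `s ≤ tan θ ≤ s⁻¹`. -/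
lemma phragmenLindelof_sector {F : ℂ → ℂ} (hF : Differentiable ℂ F) {C A s : ℝ} (hA : 0 ≤ A)
    (hs0 : 0 < s) (hs1 : s < 1)
    (h1 : ∀ z, ‖F z‖ ≤ C * Real.exp (A * (z.im ^ 2 + s ^ 2 * z.re ^ 2)))
    (h2 : ∀ z, ‖F z‖ ≤ C * Real.exp (A * (z.re ^ 2 + s ^ 2 * z.im ^ 2)))
    {z : ℂ} (hre : 0 < z.re) (him : s * z.re ≤ z.im) (him' : s * z.im ≤ z.re) :
    ‖F z‖ ≤ C * Real.exp (2 * A * s * (z.re * z.im)) := by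
  have hC : 0 ≤ C := by
    have := (norm_nonneg _).trans (h1 0)
    simpa using this
  set θ := Real.arctan s
  have hθ0 : 0 < θ := Real.arctan_pos.2 hs0
  have hθ1 : θ < Real.pi / 4 := by
    rw [← Real.arctan_one]; exact Real.arctan_strictMono hs1
  have hcos : 0 < Real.cos θ := Real.cos_arctan_pos s
  have hsin : Real.sin θ = s * Real.cos θ := by
    have : Real.sin θ / Real.cos θ = s := by rw [← Real.tan_eq_sin_div_cos, Real.tan_arctan]
    rwa [div_eq_iff hcos.ne'] at this
  -- Where `tan θ` is `s` or `s⁻¹`, the hypotheses `h1` and `h2` respectively read `C exp(2As · re ·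
  -- im)`; the factor `E` cancels exactly this growth, so `F · E` is bounded by `C` on both rays.
  -- The logarithm carries the sector to a strip.
  set E : ℂ → ℂ := fun z => Complex.exp (I * (A * s : ℝ) * z ^ 2)
  have hE : ∀ z, ‖E z‖ = Real.exp (-(2 * A * s * (z.re * z.im))) := fun z => by
    rw [Complex.norm_exp]
    congr 1
    simp [pow_two]
    ring
  set G : ℂ → ℂ := fun w => F (Complex.exp w) * E (Complex.exp w)
  have hGd : Differentiable ℂ G := by
    have : Differentiable ℂ E := by fun_prop
    exact (hF.comp Complex.differentiable_exp).mul (this.comp Complex.differentiable_exp)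
  have hG : ∀ w, ‖G w‖ = ‖F (Complex.exp w)‖ *
      Real.exp (-(2 * A * s * ((Complex.exp w).re * (Complex.exp w).im))) := fun w => by
    rw [norm_mul, hE]
  have hstrip : ‖G (log z)‖ ≤ C := by
    have harg : arg z = Real.arctan (z.im / z.re) := by
      have := abs_lt.1 (abs_arg_lt_pi_div_two_iff.2 (Or.inl hre))
      rw [← Complex.tan_arg, Real.arctan_tan this.1 this.2]
    refine PhragmenLindelof.horizontal_strip (a := θ) (b := Real.pi / 2 - θ)
      hGd.diffContOnCl ⟨2, ?_, A * (1 + s), ?_⟩ ?_ ?_ ?_ ?_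
    -- Growth of order 2 is admissible because the opening `π/2 - 2θ` is strictly less than `π/2`.
    · rw [lt_div_iff₀ (by linarith)]
      linarith
    · refine Asymptotics.IsBigO.of_bound C (Eventually.of_forall fun w => ?_)
      rw [hG, Real.norm_of_nonneg (Real.exp_pos _).le]
      set u := Complex.exp w
      have hu : u.re ^ 2 + u.im ^ 2 = Real.exp (2 * w.re) := by
        have : ‖u‖ = Real.exp w.re := Complex.norm_exp w
        rw [two_mul, Real.exp_add, ← this, ← pow_two, Complex.sq_norm, normSq_apply]
        ring
      have hle : Real.exp (2 * w.re) ≤ Real.exp (2 * |w.re|) :=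
        Real.exp_le_exp.2 (by linarith [le_abs_self w.re])
      refine (mul_le_mul_of_nonneg_right (h1 u) (Real.exp_pos _).le).trans ?_
      rw [mul_assoc, ← Real.exp_add]
      gcongr
      have e1 : u.im ^ 2 + s ^ 2 * u.re ^ 2 ≤ Real.exp (2 * |w.re|) := by
        have := mul_le_mul_of_nonneg_right (show s ^ 2 ≤ 1 by nlinarith) (sq_nonneg u.re)
        linarith
      have e2 : -(2 * (u.re * u.im)) ≤ Real.exp (2 * |w.re|) := by
        nlinarith [sq_nonneg (u.re + u.im)]
      have e3 := mul_le_mul_of_nonneg_left e1 hA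
      have e4 := mul_le_mul_of_nonneg_left e2 (mul_nonneg hA hs0.le)
      linarith
    · intro w hw
      rw [hG, Real.exp_neg, ← div_eq_mul_inv, div_le_iff₀ (Real.exp_pos _)]
      refine (h1 _).trans_eq ?_
      rw [Complex.exp_re, Complex.exp_im, hw, hsin]
      ring_nf
    · intro w hw
      rw [hG, Real.exp_neg, ← div_eq_mul_inv, div_le_iff₀ (Real.exp_pos _)]
      refine (h2 _).trans_eq ?_
      rw [Complex.exp_re, Complex.exp_im, hw, Real.cos_pi_div_two_sub, Real.sin_pi_div_two_sub,
        hsin]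
      ring_nf
    · rw [log_im, harg]
      exact Real.arctan_mono ((le_div_iff₀ hre).2 him)
    · rw [log_im, harg, ← Real.arctan_inv_of_pos hs0]
      refine Real.arctan_mono ?_
      rw [div_le_iff₀ hre, inv_mul_eq_div, le_div_iff₀ hs0]
      linarith
  have hz : z ≠ 0 := fun h => by simp [h] at hre
  rw [hG, exp_log hz, Real.exp_neg, ← div_eq_mul_inv, div_le_iff₀ (Real.exp_pos _)] at hstrip
  exact hstrip

open Complex in
/-- An entire function of order two whose growth is small along both coordinate axes has small
type in all directions. -/
lemma norm_le_of_quadratic_growth_axes {F : ℂ → ℂ} (hF : Differentiable ℂ F) {C A s : ℝ}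
    (hA : 0 ≤ A) (hs0 : 0 < s) (hs1 : s < 1)
    (h1 : ∀ z, ‖F z‖ ≤ C * Real.exp (A * (z.im ^ 2 + s ^ 2 * z.re ^ 2)))
    (h2 : ∀ z, ‖F z‖ ≤ C * Real.exp (A * (z.re ^ 2 + s ^ 2 * z.im ^ 2))) (z : ℂ) :
    ‖F z‖ ≤ C * Real.exp (A * (s * ‖z‖ ^ 2)) := by
  have hC : 0 ≤ C := by
    have := (norm_nonneg _).trans (h1 0)
    simpa using this
  have hn : ∀ z : ℂ, ‖z‖ ^ 2 = z.re ^ 2 + z.im ^ 2 := fun z => by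
    rw [Complex.sq_norm, normSq_apply]; ring
  have quadrant : ∀ {F : ℂ → ℂ}, Differentiable ℂ F →
      (∀ z, ‖F z‖ ≤ C * Real.exp (A * (z.im ^ 2 + s ^ 2 * z.re ^ 2))) →
      (∀ z, ‖F z‖ ≤ C * Real.exp (A * (z.re ^ 2 + s ^ 2 * z.im ^ 2))) →
      ∀ z : ℂ, 0 ≤ z.re → 0 ≤ z.im → ‖F z‖ ≤ C * Real.exp (A * (s * ‖z‖ ^ 2)) := by
    intro F hF h1 h2 z hre him
    rw [hn]
    -- Since `s < 1`, the condition `im² ≤ s re²` is equivalent to `im² + s² re² ≤ s |z|²`, so `h1`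
    -- suffices near the real axis and `h2` near the imaginary one. What remains lies inside the
    -- sector, where `2 re im ≤ |z|²` finishes.
    rcases le_or_gt (z.im ^ 2) (s * z.re ^ 2) with h | h
    · refine (h1 z).trans ?_
      gcongr
      nlinarith
    rcases le_or_gt (z.re ^ 2) (s * z.im ^ 2) with h' | h'
    · refine (h2 z).trans ?_
      gcongr
      nlinarith
    have hre' : 0 < z.re := by
      refine lt_of_le_of_ne hre fun h0 => ?_
      rw [← h0] at h'
      nlinarith [sq_nonneg z.im]
    refine (phragmenLindelof_sector hF hA hs0 hs1 h1 h2 hre' ?_ ?_).trans ?_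
    · refine le_of_sq_le_sq ?_ him
      nlinarith [sq_nonneg z.re]
    · refine le_of_sq_le_sq ?_ hre
      nlinarith [sq_nonneg z.im]
    · refine mul_le_mul_of_nonneg_left (Real.exp_le_exp.2 ?_) hC
      have := mul_nonneg (mul_nonneg hA hs0.le) (sq_nonneg (z.re - z.im))
      linarith
  rcases le_total 0 z.re with hre | hre <;> rcases le_total 0 z.im with him | him
  · exact quadrant hF h1 h2 z hre him
  -- A quarter turn exchanges the roles of `h1` and `h2`; a half turn preserves them.
  · have := quadrant (F := fun w => F (-I * w)) (hF.comp (by fun_prop))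
      (fun w => by simpa using h2 (-I * w)) (fun w => by simpa using h1 (-I * w)) (I * z)
      (by simpa using him) (by simpa using hre)
    simpa [← mul_assoc] using this
  · have := quadrant (F := fun w => F (I * w)) (hF.comp (by fun_prop))
      (fun w => by simpa using h2 (I * w)) (fun w => by simpa using h1 (I * w)) (-I * z)
      (by simpa using him) (by simpa using hre)
    simpa [← mul_assoc] using this
  · have := quadrant (F := fun w => F (-w)) (hF.comp (by fun_prop))
      (fun w => by simpa using h1 (-w)) (fun w => by simpa using h2 (-w)) (-z)
      (by simpa using hre) (by simpa using him)
    simpa using this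

/-! ### The Bargmann-type transform and its growth. -/

/-- The kernel `exp(-|t|²/2 + 2ζ⟨x,t⟩ - ζ²|x|²)` of a Bargmann-type transform. -/
noncomputable def bargmannKernel {d : ℕ} (ζ : ℂ) (x t : EuclideanSpace ℝ (Fin d)) : ℂ :=
  Complex.exp (-(1 / 2) * (‖t‖ : ℂ) ^ 2 + 2 * ζ * ((inner ℝ x t : ℝ) : ℂ) - ζ ^ 2 * (‖x‖ : ℂ) ^ 2)

/-- The transform `∫ f(t) exp(-|t|²/2 + 2ζ⟨x,t⟩ - ζ²|x|²) dt`, which is the Bargmann transform of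
`f` at `ζ x`, up to normalization. -/
noncomputable def bargmannTransform {d : ℕ} (f : EuclideanSpace ℝ (Fin d) → ℂ) (ζ : ℂ)
    (x : EuclideanSpace ℝ (Fin d)) : ℂ :=
  ∫ t, f t * bargmannKernel ζ x t

lemma norm_bargmannKernel {d : ℕ} (ζ : ℂ) (x t : EuclideanSpace ℝ (Fin d)) :
    ‖bargmannKernel ζ x t‖ = Real.exp (-(1 / 2) * ‖t‖ ^ 2 + 2 * ζ.re * inner ℝ x t -
      (ζ.re ^ 2 - ζ.im ^ 2) * ‖x‖ ^ 2) := by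
  rw [bargmannKernel, Complex.norm_exp]
  congr 1
  simp [pow_two]

lemma continuous_bargmannKernel {d : ℕ} (ζ : ℂ) :
    Continuous (fun p : EuclideanSpace ℝ (Fin d) × EuclideanSpace ℝ (Fin d) =>
      bargmannKernel ζ p.1 p.2) := by
  unfold bargmannKernel
  fun_prop

section decay

variable {d : ℕ} {f : EuclideanSpace ℝ (Fin d) → ℂ} {lam C : ℝ}

lemma integrable_exp_neg_mul_norm_sq {d : ℕ} {b : ℝ} (hb : 0 < b) :
    MeasureTheory.Integrable (fun x : EuclideanSpace ℝ (Fin d) => Real.exp (-b * ‖x‖ ^ 2)) := by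
  have := (GaussianFourier.integrable_cexp_neg_mul_sq_norm_add (b := b) (by simpa using hb) 0
    (0 : EuclideanSpace ℝ (Fin d))).norm
  refine this.congr (Filter.Eventually.of_forall fun x => ?_)
  simp only [zero_mul, add_zero, Complex.norm_exp]
  rw [← Complex.ofReal_pow, ← Complex.ofReal_neg, ← Complex.ofReal_mul, Complex.ofReal_re]

lemma integrable_of_gaussian_decay (hf : MeasureTheory.AEStronglyMeasurable f)
    (hlam : lam < 1 / 2) (hdecay : ∀ᵐ x, ‖f x‖ ≤ C * Real.exp (-(1 / 2 - lam) * ‖x‖ ^ 2)) :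
    MeasureTheory.Integrable f :=
  ((integrable_exp_neg_mul_norm_sq (by linarith)).const_mul C).mono' hf hdecay

/-- Completing the square centres the Gaussian in `t` at `(Re ζ / (1 - lam)) x` and leaves the
coefficient `1 / (1 - lam) - 1 = lam / (1 - lam)` of `(Re ζ)² |x|²`. -/
lemma norm_bargmannTransform_le (hlam : lam < 1)
    (hdecay : ∀ᵐ x, ‖f x‖ ≤ C * Real.exp (-(1 / 2 - lam) * ‖x‖ ^ 2)) (ζ : ℂ)
    (x : EuclideanSpace ℝ (Fin d)) :
    ‖bargmannTransform f ζ x‖ ≤ C * (Real.pi / (1 - lam)) ^ ((d : ℝ) / 2) *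
      Real.exp (‖x‖ ^ 2 * (ζ.im ^ 2 + lam / (1 - lam) * ζ.re ^ 2)) := by
  have hb : 0 < 1 - lam := by linarith
  set E := Real.exp (‖x‖ ^ 2 * (ζ.im ^ 2 + lam / (1 - lam) * ζ.re ^ 2))
  have hint := (integrable_exp_neg_mul_norm_sq (d := d) hb).comp_sub_right
    ((ζ.re / (1 - lam)) • x)
  have key := MeasureTheory.norm_integral_le_of_norm_le (hint.const_mul (C * E))
    (f := fun t => f t * bargmannKernel ζ x t) ?_
  · refine key.trans_eq ?_
    rw [MeasureTheory.integral_const_mul, MeasureTheory.integral_sub_right_eq_self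
      (fun t : EuclideanSpace ℝ (Fin d) => Real.exp (-(1 - lam) * ‖t‖ ^ 2)),
      GaussianFourier.integral_rexp_neg_mul_sq_norm hb]
    simp only [finrank_euclideanSpace, Fintype.card_fin]
    ring
  · filter_upwards [hdecay] with t ht
    rw [norm_mul]
    refine (mul_le_mul_of_nonneg_right ht (norm_nonneg _)).trans_eq ?_
    rw [norm_bargmannKernel, mul_assoc C, mul_assoc C, ← Real.exp_add, ← Real.exp_add]
    congr 2
    rw [norm_sub_sq_real, inner_smul_right, norm_smul, mul_pow, Real.norm_eq_abs, sq_abs,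
      real_inner_comm x t]
    field_simp
    ring

lemma differentiable_bargmannTransform (hf : MeasureTheory.AEStronglyMeasurable f)
    (hlam : lam < 1 / 2) (hdecay : ∀ᵐ x, ‖f x‖ ≤ C * Real.exp (-(1 / 2 - lam) * ‖x‖ ^ 2))
    (x : EuclideanSpace ℝ (Fin d)) :
    Differentiable ℂ (fun ζ => bargmannTransform f ζ x) := by
  rw [← differentiableOn_univ]
  refine differentiableOn_integral_of_dominated isOpen_univ (fun z _ => ?_)
    (Filter.Eventually.of_forall fun t => ?_) fun z₀ _ => ?_
  · exact hf.mul ((continuous_bargmannKernel z).comp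
      (by fun_prop : Continuous fun t => (x, t))).aestronglyMeasurable
  · unfold bargmannKernel
    fun_prop
  · set R := ‖z₀‖ + 1
    refine ⟨Metric.ball z₀ 1, Metric.ball_mem_nhds _ one_pos, fun t =>
      C * Real.exp (3 * R ^ 2 * ‖x‖ ^ 2) * Real.exp (-(1 / 2 - lam) * ‖t‖ ^ 2),
      (integrable_exp_neg_mul_norm_sq (by linarith)).const_mul _, ?_⟩
    filter_upwards [hdecay] with t ht z hz
    have hzR : ‖z‖ ≤ R := by
      have : ‖z - z₀‖ < 1 := by simpa [dist_eq_norm] using hz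
      linarith [norm_le_norm_add_norm_sub' z z₀]
    have hre := (Complex.abs_re_le_norm z).trans hzR
    have him := (Complex.abs_im_le_norm z).trans hzR
    have hR : 0 ≤ R := (norm_nonneg z).trans hzR
    have h1 : z.re * inner ℝ x t ≤ R * (‖x‖ * ‖t‖) := by
      refine (le_abs_self _).trans ?_
      rw [abs_mul]
      exact mul_le_mul hre (abs_real_inner_le_norm x t) (abs_nonneg _) hR
    have h2 : z.im ^ 2 ≤ R ^ 2 := sq_le_sq' (abs_le.1 him).1 (abs_le.1 him).2
    -- Maximizing `-|t|²/2 + 2R|x||t|` over `|t|` costs `2R²|x|²`; the term `(Im z)²|x|²` costs one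
    -- more `R²|x|²`.
    have hk : ‖bargmannKernel z x t‖ ≤ Real.exp (3 * R ^ 2 * ‖x‖ ^ 2) := by
      rw [norm_bargmannKernel, Real.exp_le_exp]
      nlinarith [sq_nonneg (‖t‖ - 2 * (R * ‖x‖)), mul_le_mul_of_nonneg_right h2 (sq_nonneg ‖x‖),
        mul_nonneg (sq_nonneg z.re) (sq_nonneg ‖x‖)]
    rw [norm_mul]
    calc ‖f t‖ * ‖bargmannKernel z x t‖
        ≤ (C * Real.exp (-(1 / 2 - lam) * ‖t‖ ^ 2)) * Real.exp (3 * R ^ 2 * ‖x‖ ^ 2) :=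
          mul_le_mul ht hk (norm_nonneg _) ((norm_nonneg _).trans ht)
      _ = _ := by ring

end decay

lemma integral_cexp_neg_half_sq_norm_add {d : ℕ} (c : Fin d → ℂ) :
    ∫ v : EuclideanSpace ℝ (Fin d), Complex.exp (-(1 / 2) * (‖v‖ : ℂ) ^ 2 + ∑ i, c i * (v i : ℂ)) =
      (((2 * Real.pi) ^ ((d : ℝ) / 2) : ℝ) : ℂ) * Complex.exp ((∑ i, c i ^ 2) / 2) := by
  have h := GaussianFourier.integral_cexp_neg_mul_sum_add (ι := Fin d) (b := 1 / 2)
    (by norm_num) c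
  rw [← (PiLp.volume_preserving_toLp (Fin d)).integral_comp
    (MeasurableEquiv.toLp 2 _).measurableEmbedding]
  convert! h using 3
  · rename_i v
    congr 1
    have : ((‖WithLp.toLp 2 v‖ : ℝ) : ℂ) ^ 2 = ∑ i, (v i : ℂ) ^ 2 := by
      rw [← Complex.ofReal_pow, EuclideanSpace.norm_sq_eq]
      simp
    simp [this]
  · rw [Complex.ofReal_cpow (by positivity)]
    push_cast
    congr 1
    · ring
    · simp
  · norm_num

lemma integrable_bargmannKernel {d : ℕ} (ζ : ℂ) (x : EuclideanSpace ℝ (Fin d)) :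
    MeasureTheory.Integrable (bargmannKernel ζ x) := by
  have := (GaussianFourier.integrable_cexp_neg_mul_sq_norm_add (b := 1 / 2) (by norm_num) (2 * ζ)
    x).mul_const (Complex.exp (-(ζ ^ 2 * (‖x‖ : ℂ) ^ 2)))
  refine this.congr (Filter.Eventually.of_forall fun t => ?_)
  simp only [bargmannKernel]
  rw [← Complex.exp_add, sub_eq_add_neg]

/-- The Fourier integral of a complex Gaussian, with the linear coefficients `2iζ xᵢ - i tᵢ`; this
is the kernel form of the rotation by `i`. -/
lemma integral_fourier_bargmannKernel {d : ℕ} (ζ : ℂ) (x t : EuclideanSpace ℝ (Fin d)) :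
    ∫ ξ, Complex.exp (-Complex.I * ((inner ℝ t ξ : ℝ) : ℂ)) *
        bargmannKernel (Complex.I * ζ) x ξ =
      (((2 * Real.pi) ^ ((d : ℝ) / 2) : ℝ) : ℂ) * bargmannKernel ζ x t := by
  have hinner : ∀ u v : EuclideanSpace ℝ (Fin d),
      ((inner ℝ u v : ℝ) : ℂ) = ∑ i, (u i : ℂ) * (v i : ℂ) := fun u v => by
    rw [PiLp.inner_apply]
    push_cast
    refine Finset.sum_congr rfl fun i _ => ?_
    simp [mul_comm]
  have hnorm : ∀ u : EuclideanSpace ℝ (Fin d), (‖u‖ : ℂ) ^ 2 = ∑ i, (u i : ℂ) ^ 2 := fun u => by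
    rw [← Complex.ofReal_pow, EuclideanSpace.norm_sq_eq]
    simp
  have h := integral_cexp_neg_half_sq_norm_add
    (fun i => 2 * Complex.I * ζ * (x i : ℂ) - Complex.I * (t i : ℂ))
  have e1 : ∀ ξ, Complex.exp (-Complex.I * ((inner ℝ t ξ : ℝ) : ℂ)) *
      bargmannKernel (Complex.I * ζ) x ξ = Complex.exp (-(1 / 2) * (‖ξ‖ : ℂ) ^ 2 +
        ∑ i, (2 * Complex.I * ζ * (x i : ℂ) - Complex.I * (t i : ℂ)) * (ξ i : ℂ)) *
        Complex.exp (ζ ^ 2 * (‖x‖ : ℂ) ^ 2) := fun ξ => by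
    rw [bargmannKernel, ← Complex.exp_add, ← Complex.exp_add]
    congr 1
    have : ∑ i, (2 * Complex.I * ζ * (x i : ℂ) - Complex.I * (t i : ℂ)) * (ξ i : ℂ) =
        2 * Complex.I * ζ * ((inner ℝ x ξ : ℝ) : ℂ) -
          Complex.I * ((inner ℝ t ξ : ℝ) : ℂ) := by
      rw [hinner, hinner, Finset.mul_sum, Finset.mul_sum, ← Finset.sum_sub_distrib]
      refine Finset.sum_congr rfl fun i _ => ?_
      ring
    rw [this, mul_pow, Complex.I_sq]
    ring
  simp_rw [e1]
  rw [MeasureTheory.integral_mul_const, h, mul_assoc, ← Complex.exp_add, bargmannKernel]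
  congr 2
  have : ∑ i, (2 * Complex.I * ζ * (x i : ℂ) - Complex.I * (t i : ℂ)) ^ 2 =
      -4 * ζ ^ 2 * (‖x‖ : ℂ) ^ 2 + 4 * ζ * ((inner ℝ x t : ℝ) : ℂ) - (‖t‖ : ℂ) ^ 2 := by
    rw [hinner, hnorm, hnorm, Finset.mul_sum, Finset.mul_sum, ← Finset.sum_add_distrib,
      ← Finset.sum_sub_distrib]
    refine Finset.sum_congr rfl fun i _ => ?_
    linear_combination (2 * ζ * (x i : ℂ) - (t i : ℂ)) ^ 2 * Complex.I_sq
  rw [this]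
  ring

/-- Parseval: the Fourier transform corresponds to a rotation by `π/2`. -/
lemma bargmannTransform_fourierHat {d : ℕ} {f : EuclideanSpace ℝ (Fin d) → ℂ}
    (hf : MeasureTheory.Integrable f) (ζ : ℂ) (x : EuclideanSpace ℝ (Fin d)) :
    bargmannTransform (fourierHat f) (Complex.I * ζ) x = bargmannTransform f ζ x := by
  have hint : MeasureTheory.Integrable
      (fun p : EuclideanSpace ℝ (Fin d) × EuclideanSpace ℝ (Fin d) =>
        f p.2 * Complex.exp (-Complex.I * ((inner ℝ p.2 p.1 : ℝ) : ℂ)) *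
          bargmannKernel (Complex.I * ζ) x p.1) := by
    have h1 := (integrable_bargmannKernel (Complex.I * ζ) x).mul_prod hf
    refine (h1.bdd_mul (c := 1)
      (f := fun p => Complex.exp (-Complex.I * ((inner ℝ p.2 p.1 : ℝ) : ℂ)))
      (by fun_prop) (Filter.Eventually.of_forall fun p => ?_)).congr
      (Filter.Eventually.of_forall fun p => ?_)
    · simp [Complex.norm_exp]
    · simp only; ring
  have hpos : (0 : ℝ) < 2 * Real.pi := by positivity
  have hone : (((2 * Real.pi) ^ (-(d : ℝ) / 2) : ℝ) : ℂ) *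
      (((2 * Real.pi) ^ ((d : ℝ) / 2) : ℝ) : ℂ) = 1 := by
    rw [← Complex.ofReal_mul, ← Real.rpow_add hpos]
    simp [neg_div]
  simp only [bargmannTransform, fourierHat]
  simp_rw [mul_assoc, ← MeasureTheory.integral_mul_const]
  rw [MeasureTheory.integral_const_mul, MeasureTheory.integral_integral_swap hint]
  simp_rw [mul_assoc, MeasureTheory.integral_const_mul, integral_fourier_bargmannKernel]
  rw [← MeasureTheory.integral_const_mul]
  congr 1
  ext t
  linear_combination (f t * bargmannKernel ζ x t) * hone

/-- Gaussian decay of `f` and of its Fourier transform bounds the type of the transform in all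
complex directions. -/
lemma exists_norm_bargmannTransform_le {d : ℕ} {f : EuclideanSpace ℝ (Fin d) → ℂ} {lam C₁ C₂ : ℝ}
    (hf : MeasureTheory.AEStronglyMeasurable f) (hlam0 : 0 < lam) (hlam : lam < 1 / 2)
    (h₁ : ∀ᵐ x, ‖f x‖ ≤ C₁ * Real.exp (-(1 / 2 - lam) * ‖x‖ ^ 2))
    (h₂ : ∀ᵐ x, ‖fourierHat f x‖ ≤ C₂ * Real.exp (-(1 / 2 - lam) * ‖x‖ ^ 2)) :
    ∃ C : ℝ, ∀ ζ x, ‖bargmannTransform f ζ x‖ ≤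
      C * Real.exp (‖x‖ ^ 2 * (Real.sqrt (lam / (1 - lam)) * ‖ζ‖ ^ 2)) := by
  have hlam1 : lam < 1 := by linarith
  have hκ0 : 0 < lam / (1 - lam) := div_pos hlam0 (by linarith)
  have hκ1 : lam / (1 - lam) < 1 := by
    rw [div_lt_one (by linarith)]
    linarith
  set P := (Real.pi / (1 - lam)) ^ ((d : ℝ) / 2)
  refine ⟨max (C₁ * P) (C₂ * P), fun ζ x => ?_⟩
  refine norm_le_of_quadratic_growth_axes (F := fun ζ => bargmannTransform f ζ x)
    (differentiable_bargmannTransform hf hlam h₁ x) (sq_nonneg _) (Real.sqrt_pos.2 hκ0)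
    ((Real.sqrt_lt' one_pos).2 (by simpa using hκ1)) (fun z => ?_) (fun z => ?_) ζ
  · rw [Real.sq_sqrt hκ0.le]
    refine (norm_bargmannTransform_le hlam1 h₁ z x).trans ?_
    gcongr
    exact le_max_left _ _
  · rw [Real.sq_sqrt hκ0.le, ← bargmannTransform_fourierHat
      (integrable_of_gaussian_decay hf hlam h₁)]
    refine (norm_bargmannTransform_le hlam1 h₂ (Complex.I * z) x).trans ?_
    simp only [Complex.mul_im, Complex.mul_re, Complex.I_re, Complex.I_im, zero_mul, one_mul,
      zero_add, zero_sub, neg_sq]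
    gcongr
    exact le_max_right _ _

/-! ### Pairing the transform with Hermite functions. -/

lemma hermiteFunction_mul_exp {d : ℕ} (α : Fin d → ℕ) (x : EuclideanSpace ℝ (Fin d)) :
    hermiteFunction α x * Real.exp (-(1 / 2) * ‖x‖ ^ 2) = hermiteNormalizer α * gaussPartial α x := by
  have : Real.exp (1 / 2 * ‖x‖ ^ 2) * Real.exp (-(1 / 2) * ‖x‖ ^ 2) = 1 := by
    rw [← Real.exp_add]
    simp
  rw [hermiteFunction_eq]
  linear_combination (hermiteNormalizer α * gaussPartial α x) * this

/-- Pairing of the transform with a Hermite function; its `|α|`-th Taylor coefficient at `0` is a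
multiple of the Hermite coefficient of `f`. -/
noncomputable def hermitePairing {d : ℕ} (f : EuclideanSpace ℝ (Fin d) → ℂ) (α : Fin d → ℕ)
    (ζ : ℂ) : ℂ :=
  ∫ x, ((hermiteFunction α x * Real.exp (-(1 / 2) * ‖x‖ ^ 2) : ℝ) : ℂ) * bargmannTransform f ζ x

lemma aestronglyMeasurable_bargmannTransform {d : ℕ} {f : EuclideanSpace ℝ (Fin d) → ℂ}
    (hf : MeasureTheory.AEStronglyMeasurable f) (ζ : ℂ) :
    MeasureTheory.AEStronglyMeasurable (bargmannTransform f ζ) :=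
  MeasureTheory.AEStronglyMeasurable.integral_prod_right'
    (f := fun p : EuclideanSpace ℝ (Fin d) × EuclideanSpace ℝ (Fin d) =>
      f p.2 * bargmannKernel ζ p.1 p.2)
    (hf.comp_snd.mul (continuous_bargmannKernel ζ).aestronglyMeasurable)

section bounds

variable {d : ℕ} {f : EuclideanSpace ℝ (Fin d) → ℂ} {C s r : ℝ}

lemma norm_hermiteFunction_mul_bargmannTransform_le (hs : 0 ≤ s)
    (hB : ∀ ζ x, ‖bargmannTransform f ζ x‖ ≤ C * Real.exp (‖x‖ ^ 2 * (s * ‖ζ‖ ^ 2)))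
    (α : Fin d → ℕ) {ζ : ℂ} (hζ : ζ ∈ Metric.ball (0 : ℂ) r) (x : EuclideanSpace ℝ (Fin d)) :
    ‖((hermiteFunction α x * Real.exp (-(1 / 2) * ‖x‖ ^ 2) : ℝ) : ℂ) * bargmannTransform f ζ x‖ ≤
      hermiteFunction α x ^ 2 + C ^ 2 * Real.exp (-(1 - 2 * (s * r ^ 2)) * ‖x‖ ^ 2) := by
  have hC : 0 ≤ C := by
    have := (norm_nonneg _).trans (hB 0 0)
    simpa using this
  have hζ' : ‖ζ‖ ^ 2 ≤ r ^ 2 := by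
    have : ‖ζ‖ < r := by simpa using hζ
    gcongr
  set b := C * Real.exp (-(1 / 2 - s * r ^ 2) * ‖x‖ ^ 2)
  have hb : Real.exp (-(1 / 2) * ‖x‖ ^ 2) * ‖bargmannTransform f ζ x‖ ≤ b := by
    calc _ ≤ Real.exp (-(1 / 2) * ‖x‖ ^ 2) * (C * Real.exp (‖x‖ ^ 2 * (s * r ^ 2))) := by
          gcongr
          refine (hB ζ x).trans ?_
          gcongr
      _ = b := by
          rw [mul_left_comm, ← Real.exp_add]
          congr 2
          ring
  have hb2 : b ^ 2 = C ^ 2 * Real.exp (-(1 - 2 * (s * r ^ 2)) * ‖x‖ ^ 2) := by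
    rw [mul_pow, ← Real.exp_nat_mul]
    congr 2
    push_cast
    ring
  rw [← hb2, norm_mul, Complex.norm_real, norm_mul, Real.norm_of_nonneg (Real.exp_pos _).le,
    mul_assoc, Real.norm_eq_abs, ← sq_abs (hermiteFunction α x)]
  -- With `ab ≤ a² + b²` the `α`-dependence is confined to `hermiteFunction α x ^ 2`, whose integral
  -- is 1.
  have := mul_le_mul_of_nonneg_left hb (abs_nonneg (hermiteFunction α x))
  nlinarith [sq_nonneg (|hermiteFunction α x| - b), sq_nonneg (|hermiteFunction α x|), sq_nonneg b]

lemma integrable_hermitePairing_bound (hsr : s * r ^ 2 < 1 / 2) (α : Fin d → ℕ) :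
    MeasureTheory.Integrable (fun x : EuclideanSpace ℝ (Fin d) =>
      hermiteFunction α x ^ 2 + C ^ 2 * Real.exp (-(1 - 2 * (s * r ^ 2)) * ‖x‖ ^ 2)) :=
  (integrable_hermiteFunction_sq α).add
    ((integrable_exp_neg_mul_norm_sq (by linarith)).const_mul _)

lemma norm_hermitePairing_le (hs : 0 ≤ s) (hsr : s * r ^ 2 < 1 / 2)
    (hB : ∀ ζ x, ‖bargmannTransform f ζ x‖ ≤ C * Real.exp (‖x‖ ^ 2 * (s * ‖ζ‖ ^ 2)))
    (α : Fin d → ℕ) {ζ : ℂ} (hζ : ζ ∈ Metric.ball (0 : ℂ) r) :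
    ‖hermitePairing f α ζ‖ ≤
      1 + C ^ 2 * (Real.pi / (1 - 2 * (s * r ^ 2))) ^ ((d : ℝ) / 2) := by
  have hpos : 0 < 1 - 2 * (s * r ^ 2) := by linarith
  refine (MeasureTheory.norm_integral_le_of_norm_le (integrable_hermitePairing_bound hsr α)
    (Filter.Eventually.of_forall
      (norm_hermiteFunction_mul_bargmannTransform_le hs hB α hζ))).trans_eq ?_
  rw [MeasureTheory.integral_add (integrable_hermiteFunction_sq α)
    ((integrable_exp_neg_mul_norm_sq hpos).const_mul _), integral_hermiteFunction_sq,
    MeasureTheory.integral_const_mul, GaussianFourier.integral_rexp_neg_mul_sq_norm hpos]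
  simp

lemma differentiableOn_hermitePairing (hf : MeasureTheory.AEStronglyMeasurable f)
    (hdiff : ∀ x, Differentiable ℂ (fun ζ => bargmannTransform f ζ x))
    (hs : 0 ≤ s) (hsr : s * r ^ 2 < 1 / 2)
    (hB : ∀ ζ x, ‖bargmannTransform f ζ x‖ ≤ C * Real.exp (‖x‖ ^ 2 * (s * ‖ζ‖ ^ 2)))
    (α : Fin d → ℕ) :
    DifferentiableOn ℂ (hermitePairing f α) (Metric.ball 0 r) := by
  refine differentiableOn_integral_of_dominated Metric.isOpen_ball (fun z _ => ?_)
    (Filter.Eventually.of_forall fun x => ((hdiff x).const_mul _).differentiableOn)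
    fun z₀ hz₀ => ⟨_, Metric.isOpen_ball.mem_nhds hz₀, _,
      integrable_hermitePairing_bound (C := C) hsr α, Filter.Eventually.of_forall fun x z hz =>
      norm_hermiteFunction_mul_bargmannTransform_le hs hB α hz x⟩
  refine MeasureTheory.AEStronglyMeasurable.mul ?_ (aestronglyMeasurable_bargmannTransform hf z)
  have := continuous_hermiteFunction α
  exact (by fun_prop : Continuous fun x : EuclideanSpace ℝ (Fin d) =>
    ((hermiteFunction α x * Real.exp (-(1 / 2) * ‖x‖ ^ 2) : ℝ) : ℂ)).aestronglyMeasurable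

end bounds

/-! ### The leading Taylor coefficient of the pairing. -/

/-- The Gaussian average `∫ e^{-|x|²} ∂^α(e^{-|·|²})(t - z x) dx`. -/
noncomputable def gaussAverage {d : ℕ} (α : Fin d → ℕ) (z : ℝ) (t : EuclideanSpace ℝ (Fin d)) : ℝ :=
  ∫ x, Real.exp (-‖x‖ ^ 2) * gaussPartial α (t - z • x)

lemma two_mul_inner_le_of_le {d : ℕ} {z : ℝ} (hz0 : 0 ≤ z) (hz : z ≤ 1 / 4)
    (x t : EuclideanSpace ℝ (Fin d)) : 2 * z * inner ℝ x t ≤ 1 / 4 * (‖x‖ ^ 2 + ‖t‖ ^ 2) := by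
  have h2 : 2 * inner ℝ x t ≤ ‖x‖ ^ 2 + ‖t‖ ^ 2 := by
    have := norm_sub_sq_real x t
    nlinarith [sq_nonneg ‖x - t‖]
  nlinarith [mul_le_mul_of_nonneg_left h2 hz0,
    mul_le_mul_of_nonneg_right hz (add_nonneg (sq_nonneg ‖x‖) (sq_nonneg ‖t‖))]

/-- After Fubini, the kernel at real `z` is `e^{|t|²/2} e^{-|t - zx|²}`, and integration by parts in
`x` yields the power of `z`. Small real `z ≥ 0` are enough, since the Taylor coefficient is read off
along them. -/
lemma hermitePairing_ofReal {d : ℕ} {f : EuclideanSpace ℝ (Fin d) → ℂ} {lam C : ℝ}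
    (hf : MeasureTheory.AEStronglyMeasurable f) (hlam : lam < 1 / 2)
    (hdecay : ∀ᵐ x, ‖f x‖ ≤ C * Real.exp (-(1 / 2 - lam) * ‖x‖ ^ 2)) (α : Fin d → ℕ) {z : ℝ}
    (hz0 : 0 ≤ z) (hz : z ≤ 1 / 4) :
    hermitePairing f α z = (z : ℂ) ^ multiLength α *
      ∫ t, f t * ((hermiteNormalizer α * Real.exp (1 / 2 * ‖t‖ ^ 2) * gaussAverage α z t : ℝ) :
        ℂ) := by
  set N := hermiteNormalizer α
  obtain ⟨D, hD0, hD⟩ := exists_abs_gaussPartial_le α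
  have hint : MeasureTheory.Integrable
      (fun p : EuclideanSpace ℝ (Fin d) × EuclideanSpace ℝ (Fin d) =>
        ((N * gaussPartial α p.1 : ℝ) : ℂ) * (f p.2 * bargmannKernel z p.1 p.2)) := by
    have hg := ((integrable_exp_neg_mul_norm_sq (d := d) (b := 1 / 2) (by norm_num)).const_mul
      (|N| * D)).mul_prod ((integrable_exp_neg_mul_norm_sq (d := d) (b := 1 / 4)
        (by norm_num)).const_mul C)
    refine hg.mono' ?_ ?_
    · have := continuous_gaussPartial α
      exact (by fun_prop : Continuous fun p : EuclideanSpace ℝ (Fin d) × EuclideanSpace ℝ (Fin d) =>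
        ((N * gaussPartial α p.1 : ℝ) : ℂ)).aestronglyMeasurable.mul
          (hf.comp_snd.mul (continuous_bargmannKernel z).aestronglyMeasurable)
    · filter_upwards [MeasureTheory.Measure.quasiMeasurePreserving_snd.ae hdecay] with p hp
      have hC : 0 ≤ C := by
        by_contra hC
        exact absurd ((norm_nonneg _).trans hp)
          (not_le.2 (mul_neg_of_neg_of_pos (not_le.1 hC) (Real.exp_pos _)))
      rw [norm_mul, norm_mul, Complex.norm_real, norm_mul, Real.norm_eq_abs, Real.norm_eq_abs]
      calc |N| * |gaussPartial α p.1| * (‖f p.2‖ * ‖bargmannKernel z p.1 p.2‖)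
          ≤ |N| * (D * Real.exp (-(3 / 4) * ‖p.1‖ ^ 2)) *
            ((C * Real.exp (-(1 / 2 - lam) * ‖p.2‖ ^ 2)) * ‖bargmannKernel z p.1 p.2‖) := by
            gcongr
            exact hD _
        _ = |N| * D * C * Real.exp (-(3 / 4) * ‖p.1‖ ^ 2 + (-(1 / 2 - lam) * ‖p.2‖ ^ 2 +
            (-(1 / 2) * ‖p.2‖ ^ 2 + 2 * z * inner ℝ p.1 p.2 - z ^ 2 * ‖p.1‖ ^ 2))) := by
            rw [norm_bargmannKernel, Real.exp_add, Real.exp_add]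
            simp only [Complex.ofReal_re, Complex.ofReal_im]
            ring_nf
        _ ≤ |N| * D * C * Real.exp (-(1 / 2) * ‖p.1‖ ^ 2 + -(1 / 4 : ℝ) * ‖p.2‖ ^ 2) := by
            refine mul_le_mul_of_nonneg_left (Real.exp_le_exp.2 ?_) (by positivity)
            have := two_mul_inner_le_of_le hz0 hz p.1 p.2
            nlinarith [sq_nonneg (z * ‖p.1‖), mul_nonneg (sub_pos.2 hlam).le (sq_nonneg ‖p.2‖)]
        _ = _ := by
            rw [Real.exp_add]
            ring
  have hker : ∀ x t : EuclideanSpace ℝ (Fin d), bargmannKernel z x t =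
      ((Real.exp (1 / 2 * ‖t‖ ^ 2) * Real.exp (-‖t - z • x‖ ^ 2) : ℝ) : ℂ) := fun x t => by
    rw [← Real.exp_add, norm_sub_sq_real, inner_smul_right, norm_smul, mul_pow, Real.norm_eq_abs,
      sq_abs, real_inner_comm x t, bargmannKernel, Complex.ofReal_exp]
    congr 1
    push_cast
    ring
  simp only [hermitePairing, bargmannTransform, hermiteFunction_mul_exp]
  simp_rw [← MeasureTheory.integral_const_mul]
  rw [MeasureTheory.integral_integral_swap hint]
  congr 1
  ext t
  have hmain := integral_gaussPartial_mul_gaussian_comp α z t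
  rw [gaussAverage]
  calc ∫ x, ((N * gaussPartial α x : ℝ) : ℂ) * (f t * bargmannKernel z x t)
      = ∫ x, (f t * ((N * Real.exp (1 / 2 * ‖t‖ ^ 2) : ℝ) : ℂ)) *
          ((gaussPartial α x * Real.exp (-‖t - z • x‖ ^ 2) : ℝ) : ℂ) := by
        congr 1
        ext x
        rw [hker]
        push_cast
        ring
    _ = _ := by
        rw [MeasureTheory.integral_const_mul, integral_complex_ofReal, hmain]
        push_cast
        ring

open Filter Topology in
lemma tendsto_integral_mul_gaussAverage {d : ℕ} {f : EuclideanSpace ℝ (Fin d) → ℂ} {lam C : ℝ}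
    (hf : MeasureTheory.AEStronglyMeasurable f) (hlam : lam < 1 / 2)
    (hdecay : ∀ᵐ x, ‖f x‖ ≤ C * Real.exp (-(1 / 2 - lam) * ‖x‖ ^ 2)) (α : Fin d → ℕ) :
    Tendsto (fun z : ℝ => ∫ t, f t *
      ((hermiteNormalizer α * Real.exp (1 / 2 * ‖t‖ ^ 2) * gaussAverage α z t : ℝ) : ℂ))
      (𝓝[>] 0) (𝓝 ((Real.pi ^ ((d : ℝ) / 2) : ℝ) * hermiteCoeff f α)) := by
  set N := hermiteNormalizer α
  obtain ⟨D, hD0, hD⟩ := exists_abs_gaussPartial_le α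
  have hev : ∀ᶠ z : ℝ in 𝓝[>] 0, 0 ≤ z ∧ z ≤ 1 / 4 := by
    filter_upwards [Ioc_mem_nhdsGT (show (0 : ℝ) < 1 / 4 by norm_num)] with z hz
      using ⟨hz.1.le, hz.2⟩
  -- The rate is `9/16 = 3/4 - 3/4 · 1/4`, the loss coming from the cross term with `z ≤ 1/4`. It
  -- exceeds `1/2`, so it beats the factor `e^{|t|²/2}` below.
  have hbound : ∀ z : ℝ, 0 ≤ z → z ≤ 1 / 4 → ∀ x t : EuclideanSpace ℝ (Fin d),
      ‖Real.exp (-‖x‖ ^ 2) * gaussPartial α (t - z • x)‖ ≤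
        D * Real.exp (-(9 / 16) * ‖t‖ ^ 2) * Real.exp (-(1 / 2) * ‖x‖ ^ 2) := by
    intro z hz0 hz x t
    rw [norm_mul, Real.norm_of_nonneg (Real.exp_pos _).le, Real.norm_eq_abs]
    refine (mul_le_mul_of_nonneg_left (hD _) (Real.exp_pos _).le).trans ?_
    rw [mul_left_comm, mul_assoc D, ← Real.exp_add, ← Real.exp_add]
    refine mul_le_mul_of_nonneg_left (Real.exp_le_exp.2 ?_) hD0
    rw [norm_sub_sq_real, inner_smul_right, norm_smul, mul_pow, Real.norm_eq_abs, sq_abs,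
      real_inner_comm x t]
    have := two_mul_inner_le_of_le hz0 hz x t
    nlinarith [sq_nonneg (z * ‖x‖), sq_nonneg ‖x‖]
  have hxint := integrable_exp_neg_mul_norm_sq (d := d) (b := 1 / 2) (by norm_num)
  have hcont : Continuous (gaussPartial α) := continuous_gaussPartial α
  have hA0 : ∀ t : EuclideanSpace ℝ (Fin d),
      Tendsto (fun z => gaussAverage α z t) (𝓝[>] 0)
        (𝓝 (Real.pi ^ ((d : ℝ) / 2) * gaussPartial α t)) := by
    intro t
    have hlim : ∫ x : EuclideanSpace ℝ (Fin d), Real.exp (-‖x‖ ^ 2) * gaussPartial α t =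
        Real.pi ^ ((d : ℝ) / 2) * gaussPartial α t := by
      rw [MeasureTheory.integral_mul_const]
      have := GaussianFourier.integral_rexp_neg_mul_sq_norm (V := EuclideanSpace ℝ (Fin d))
        one_pos
      simp only [neg_mul, one_mul, div_one, finrank_euclideanSpace, Fintype.card_fin] at this
      rw [this]
    rw [← hlim]
    refine MeasureTheory.tendsto_integral_filter_of_dominated_convergence _
      (Eventually.of_forall fun z => ?_) ?_ (hxint.const_mul (D * Real.exp (-(9 / 16) * ‖t‖ ^ 2)))
      (Eventually.of_forall fun x => ?_)
    · exact (by fun_prop : Continuous fun x : EuclideanSpace ℝ (Fin d) =>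
        Real.exp (-‖x‖ ^ 2) * gaussPartial α (t - z • x)).aestronglyMeasurable
    · filter_upwards [hev] with z hz
      exact Eventually.of_forall fun x => hbound z hz.1 hz.2 x t
    · have : Continuous fun z : ℝ => Real.exp (-‖x‖ ^ 2) * gaussPartial α (t - z • x) := by
        fun_prop
      exact (this.tendsto' 0 _ (by simp)).mono_left nhdsWithin_le_nhds
  have hAb : ∀ z : ℝ, 0 ≤ z → z ≤ 1 / 4 → ∀ t : EuclideanSpace ℝ (Fin d),
      ‖gaussAverage α z t‖ ≤ D * Real.exp (-(9 / 16) * ‖t‖ ^ 2) *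
        ∫ x : EuclideanSpace ℝ (Fin d), Real.exp (-(1 / 2) * ‖x‖ ^ 2) := by
    intro z hz0 hz t
    rw [← MeasureTheory.integral_const_mul]
    exact MeasureTheory.norm_integral_le_of_norm_le (hxint.const_mul _)
      (Eventually.of_forall fun x => hbound z hz0 hz x t)
  set J := ∫ x : EuclideanSpace ℝ (Fin d), Real.exp (-(1 / 2) * ‖x‖ ^ 2)
  have hlim : ((Real.pi ^ ((d : ℝ) / 2) : ℝ) : ℂ) * hermiteCoeff f α = ∫ t, f t *
      ((N * Real.exp (1 / 2 * ‖t‖ ^ 2) * (Real.pi ^ ((d : ℝ) / 2) * gaussPartial α t) : ℝ) : ℂ) := by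
    rw [hermiteCoeff, ← MeasureTheory.integral_const_mul]
    congr 1
    ext t
    rw [hermiteFunction_eq]
    push_cast
    ring
  rw [hlim]
  refine MeasureTheory.tendsto_integral_filter_of_dominated_convergence
    (fun t => C * (|N| * (D * J)) * Real.exp (-(9 / 16 - lam) * ‖t‖ ^ 2))
    (Eventually.of_forall fun z => ?_) ?_
    ((integrable_exp_neg_mul_norm_sq (by linarith)).const_mul _) (Eventually.of_forall fun t => ?_)
  · have hm : MeasureTheory.StronglyMeasurable (gaussAverage α z) :=
      MeasureTheory.StronglyMeasurable.integral_prod_right'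
        (f := fun p : EuclideanSpace ℝ (Fin d) × EuclideanSpace ℝ (Fin d) =>
          Real.exp (-‖p.2‖ ^ 2) * gaussPartial α (p.1 - z • p.2))
        (by fun_prop : Continuous fun p : EuclideanSpace ℝ (Fin d) × EuclideanSpace ℝ (Fin d) =>
          Real.exp (-‖p.2‖ ^ 2) * gaussPartial α (p.1 - z • p.2)).stronglyMeasurable
    refine hf.mul (Complex.continuous_ofReal.comp_aestronglyMeasurable ?_)
    exact ((by fun_prop : Continuous fun t : EuclideanSpace ℝ (Fin d) =>
      N * Real.exp (1 / 2 * ‖t‖ ^ 2)).stronglyMeasurable.mul hm).aestronglyMeasurable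
  · filter_upwards [hev] with z hz
    filter_upwards [hdecay] with t ht
    rw [norm_mul, Complex.norm_real, norm_mul, norm_mul, Real.norm_eq_abs N,
      Real.norm_of_nonneg (Real.exp_pos _).le]
    calc ‖f t‖ * (|N| * Real.exp (1 / 2 * ‖t‖ ^ 2) * ‖gaussAverage α z t‖)
        ≤ (C * Real.exp (-(1 / 2 - lam) * ‖t‖ ^ 2)) * (|N| * Real.exp (1 / 2 * ‖t‖ ^ 2) *
          (D * Real.exp (-(9 / 16) * ‖t‖ ^ 2) * J)) := by
          refine mul_le_mul ht ?_ (by positivity) ((norm_nonneg _).trans ht)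
          exact mul_le_mul_of_nonneg_left (hAb z hz.1 hz.2 t) (by positivity)
      _ = C * (|N| * (D * J)) * Real.exp (-(1 / 2 - lam) * ‖t‖ ^ 2 + 1 / 2 * ‖t‖ ^ 2 +
          -(9 / 16) * ‖t‖ ^ 2) := by
          rw [Real.exp_add, Real.exp_add]
          ring
      _ = _ := by
          congr 2
          ring
  · exact tendsto_const_nhds.mul ((Complex.continuous_ofReal.tendsto _).comp
      ((hA0 t).const_mul _))

/-! ### The threshold for `h` and the conclusion. -/

/-- For `lam < 1/2` one has `lam / (1 - lam) ≤ 2 lam ≤ 4 (4 lam² + lam / 2)`, and the dimension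
enters only through `√d ≥ 1`. -/
lemma two_mul_sqrt_lt_sq {d : ℕ} (hd : 1 ≤ d) {lam h : ℝ} (hlam0 : 0 < lam) (hlam : lam < 1 / 2)
    (hh : 2 * Real.sqrt d * (4 * lam ^ 2 + 1 / 2 * lam) ^ (1 / 4 : ℝ) < h) :
    2 * Real.sqrt (lam / (1 - lam)) < h ^ 2 := by
  have hpos : 0 ≤ 4 * lam ^ 2 + 1 / 2 * lam := by positivity
  set q := (4 * lam ^ 2 + 1 / 2 * lam) ^ (1 / 4 : ℝ)
  have hq0 : 0 ≤ q := Real.rpow_nonneg hpos _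
  have hq4 : q ^ 4 = 4 * lam ^ 2 + 1 / 2 * lam := by
    rw [← Real.rpow_natCast, ← Real.rpow_mul hpos]
    norm_num
  have hd1 : 1 ≤ Real.sqrt d := Real.one_le_sqrt.2 (by exact_mod_cast hd)
  have h2q : 2 * q < h := lt_of_le_of_lt (by nlinarith) hh
  have hκ : Real.sqrt (lam / (1 - lam)) ≤ 2 * q ^ 2 := by
    refine Real.sqrt_le_iff.2 ⟨by positivity, ?_⟩
    rw [div_le_iff₀ (by linarith), show (2 * q ^ 2) ^ 2 = 4 * q ^ 4 by ring, hq4]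
    nlinarith [mul_pos hlam0 hlam0, mul_pos hlam0 (sub_pos.2 hlam)]
  nlinarith

theorem proposition3p1 (d : ℕ) (f : EuclideanSpace ℝ (Fin d) → ℂ)
    (hf : MeasureTheory.MemLp f 2 MeasureTheory.volume)
    (lam : ℝ) (hlam_pos : 0 < lam) (hlam_lt : lam < 1 / 4)
    (hf_decay : ∃ C : ℝ, ∀ᵐ x ∂(MeasureTheory.volume : MeasureTheory.Measure
      (EuclideanSpace ℝ (Fin d))), ‖f x‖ ≤ C * Real.exp (-(1 / 2 - lam) * ‖x‖ ^ 2))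
    (hfhat_decay : ∃ C : ℝ, ∀ᵐ ξ ∂(MeasureTheory.volume : MeasureTheory.Measure
      (EuclideanSpace ℝ (Fin d))),
        ‖fourierHat f ξ‖ ≤ C * Real.exp (-(1 / 2 - lam) * ‖ξ‖ ^ 2)) :
    ∀ h : ℝ, 2 * Real.sqrt d * (4 * lam ^ 2 + 1 / 2 * lam) ^ (1 / 4 : ℝ) < h →
      ∃ C : ℝ, ∀ α : Fin d → ℕ, ‖hermiteCoeff f α‖ ≤ C * h ^ multiLength α := by
  intro h hh
  -- In dimension 0 the bound `√d ≥ 1` fails, but there is only one multi-index, of length 0.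
  rcases Nat.eq_zero_or_pos d with rfl | hd
  · refine ⟨‖hermiteCoeff f 0‖, fun α => ?_⟩
    rw [Subsingleton.elim α 0]
    simp [multiLength]
  obtain ⟨C₁, h₁⟩ := hf_decay
  obtain ⟨C₂, h₂⟩ := hfhat_decay
  have hlam : lam < 1 / 2 := by linarith
  have hm := hf.aestronglyMeasurable
  obtain ⟨B, hB⟩ := exists_norm_bargmannTransform_le hm hlam_pos hlam h₁ h₂
  have hh2 := two_mul_sqrt_lt_sq hd hlam_pos hlam hh
  set s := Real.sqrt (lam / (1 - lam))
  have hs : 0 ≤ s := Real.sqrt_nonneg _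
  have hh0 : 0 < h := lt_of_le_of_lt (by positivity) hh
  -- With radius `h⁻¹`, the condition for the pairing to converge is exactly `2 s < h²`.
  have hsr : s * (h⁻¹) ^ 2 < 1 / 2 := by
    rw [inv_pow, ← div_eq_mul_inv, div_lt_iff₀ (by positivity)]
    linarith
  set M := 1 + B ^ 2 * (Real.pi / (1 - 2 * (s * (h⁻¹) ^ 2))) ^ ((d : ℝ) / 2)
  set P := Real.pi ^ ((d : ℝ) / 2)
  have hP : 0 < P := Real.rpow_pos_of_pos Real.pi_pos _
  refine ⟨M / P, fun α => ?_⟩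
  have hlim : Filter.Tendsto (fun z : ℝ => hermitePairing f α z / (z : ℂ) ^ multiLength α)
      (nhdsWithin 0 (Set.Ioi 0)) (nhds ((P : ℂ) * hermiteCoeff f α)) := by
    refine (tendsto_integral_mul_gaussAverage hm hlam h₁ α).congr' ?_
    filter_upwards [Ioc_mem_nhdsGT (show (0 : ℝ) < 1 / 4 by norm_num)] with z hz
    have hz0 : (z : ℂ) ≠ 0 := by exact_mod_cast hz.1.ne'
    rw [hermitePairing_ofReal hm hlam h₁ α hz.1.le hz.2, mul_div_cancel_left₀ _ (pow_ne_zero _ hz0)]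
  have key := norm_le_of_tendsto_div_pow (inv_pos.2 hh0)
    (differentiableOn_hermitePairing hm (differentiable_bargmannTransform hm hlam h₁) hs hsr hB α)
    (fun z hz => norm_hermitePairing_le hs hsr hB α hz) hlim
  rw [norm_mul, Complex.norm_real, Real.norm_of_nonneg hP.le, inv_pow h (multiLength α), div_inv_eq_mul] at key
  rw [div_mul_eq_mul_div, le_div_iff₀ hP]
  linarith
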